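/- Let $N\ge 1$ be an integer, and let $\alpha>0$ and $\sigma>0$ be real numbers with $\sigma N<4$ and $\sigma<\max\{\frac{4}{N+1},1\}$. For $c>0$ let $S(c)=\{u\in H^2(\mathbb R^N;\mathbb C):\int_{\mathbb R^N}|u|^2\,dx=c\}$. Then $$m_\Phi(c):=\inf_{u\in S(c)}\Big(\|(\Delta+1)u\|_2^2-\frac{\alpha}{2\sigma+2}\|u\|_{2\sigma+2}^{2\sigma+2}\Big)<0\qquad\text{for all } c>0,$$ where $\|u\|_p^p=\int_{\mathbb R^N}|u|^p\,dx$. Moreover, for all $\gamma>0$ and $\beta>0$, setting $$m(c):=\inf_{u\in S(c)}\Big(\frac{\gamma}{2}\|\Delta u\|_2^2-\frac{\beta}{2}\|\nabla u\|_2^2-\frac{\alpha}{2\sigma+2}\|u\|_{2\sigma+2}^{2\sigma+2}\Big),$$ one has $$c_0:=\inf\Big\{c>0:\ m(c)<-\frac{\beta^2}{8\gamma}\,c\Big\}=0 .$$ The infima are taken in $[-\infty,+\infty]$, with $\inf\emptyset=+\infty$. -/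

import Mathlib

open MeasureTheory TemperedDistribution
open scoped SchwartzMap Laplacian LineDeriv ENNReal

noncomputable section

namespace MixedDispersion

/-- The complex Hilbert space `L²(ℝᴺ) = L²(ℝᴺ; ℂ)`; its norm is `‖u‖₂ = (∫ |u|² dx)^{1/2}`. -/
abbrev L2 (N : ℕ) : Type :=
  Lp ℂ 2 (volume : Measure (EuclideanSpace ℝ (Fin N)))

/-- The tempered distributions on `ℝᴺ`. -/
abbrev Distr (N : ℕ) : Type := 𝓢'(EuclideanSpace ℝ (Fin N), ℂ)

/-- The Sobolev space `H²(ℝᴺ)`, as a set of elements of `L²(ℝᴺ)`. -/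
def H2 (N : ℕ) : Set (L2 N) :=
  {u | MemSobolev 2 2 (u : Distr N)}

open Classical in
/-- The (unique) `L²` function that represents the distribution `T`; it is `0` if there is none. -/
def l2Rep {N : ℕ} (T : Distr N) : L2 N :=
  if h : ∃ g : L2 N, (g : Distr N) = T then h.choose else 0

/-- The distributional Laplacian `Δu` of `u ∈ H²(ℝᴺ)`, as an element of `L²(ℝᴺ)`. -/
def lap {N : ℕ} (u : L2 N) : L2 N := l2Rep (Δ (u : Distr N))

/-- The distributional partial derivative `∂ᵢu` of `u ∈ H²(ℝᴺ)`, as an element of `L²(ℝᴺ)`. -/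
def partialDeriv {N : ℕ} (i : Fin N) (u : L2 N) : L2 N :=
  l2Rep (∂_{EuclideanSpace.single i (1 : ℝ)} (u : Distr N))

/-- `‖∇u‖₂² = ∑ᵢ ‖∂ᵢu‖₂²`. -/
def gradNormSq {N : ℕ} (u : L2 N) : ℝ := ∑ i : Fin N, ‖partialDeriv i u‖ ^ 2

/-- `‖u‖_{2σ+2}^{2σ+2} = ∫ |u|^{2σ+2} dx`. This is finite for every `u ∈ H²(ℝᴺ)`
when `0 < σ` and `σ N < 4`. -/
def powerInt {N : ℕ} (σ : ℝ) (u : L2 N) : ℝ :=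
  ∫ x : EuclideanSpace ℝ (Fin N), ‖u x‖ ^ (2 * σ + 2)

/-- The sphere `S(c) = {u ∈ H²(ℝᴺ) : ∫ |u|² dx = c}`. -/
def S (N : ℕ) (c : ℝ) : Set (L2 N) :=
  {u | u ∈ H2 N ∧ ∫ x : EuclideanSpace ℝ (Fin N), ‖u x‖ ^ 2 = c}

/-- `Φ(u) = ‖(Δ + 1)u‖₂² - α/(2σ+2) ‖u‖_{2σ+2}^{2σ+2}`. -/
def Phi {N : ℕ} (α σ : ℝ) (u : L2 N) : ℝ :=
  ‖lap u + u‖ ^ 2 - α / (2 * σ + 2) * powerInt σ u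

/-- `m_Φ(c)`, the infimum of `Φ` on `S(c)`, taken in the extended reals. -/
def mPhi (N : ℕ) (α σ c : ℝ) : EReal :=
  ⨅ u ∈ S N c, ((Phi α σ u : ℝ) : EReal)

/-- `E(u) = γ/2 ‖Δu‖₂² - β/2 ‖∇u‖₂² - α/(2σ+2) ‖u‖_{2σ+2}^{2σ+2}`. -/
def energy {N : ℕ} (γ β α σ : ℝ) (u : L2 N) : ℝ :=
  γ / 2 * ‖lap u‖ ^ 2 - β / 2 * gradNormSq u - α / (2 * σ + 2) * powerInt σ u

/-- `m(c)`, the infimum of `E` on `S(c)`, taken in the extended reals. -/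
def mE (N : ℕ) (γ β α σ c : ℝ) : EReal :=
  ⨅ u ∈ S N c, ((energy γ β α σ u : ℝ) : EReal)

/-- `c₀ = inf {c > 0 : m(c) < -β²/(8γ) c}`, taken in the extended reals
(so that it would be `+∞` if there were no such `c`). -/
def c0 (N : ℕ) (γ β α σ : ℝ) : EReal :=
  ⨅ c ∈ {c : ℝ | 0 < c ∧ mE N γ β α σ c < ((-(β ^ 2 / (8 * γ)) * c : ℝ) : EReal)}, (c : EReal)

theorem l2Rep_coe {N : ℕ} (g : L2 N) : l2Rep (g : Distr N) = g := by
  have h : ∃ g' : L2 N, (g' : Distr N) = (g : Distr N) := ⟨g, rfl⟩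
  have hinj := LinearMap.ker_eq_bot.mp
    (Lp.ker_toTemperedDistributionCLM_eq_bot (F := ℂ)
      (μ := (volume : Measure (EuclideanSpace ℝ (Fin N)))) (p := 2))
  unfold l2Rep
  rw [dif_pos h]
  exact hinj h.choose_spec

theorem coe_l2Rep {N : ℕ} {T : Distr N} (h : MemSobolev 0 2 T) : (l2Rep T : Distr N) = T := by
  obtain ⟨g, rfl⟩ := memSobolev_zero_iff.mp h
  rw [l2Rep_coe]

/-- On `H²`, `lap u` really is the distributional Laplacian. -/
theorem coe_lap {N : ℕ} {u : L2 N} (hu : u ∈ H2 N) : (lap u : Distr N) = Δ (u : Distr N) := by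
  refine coe_l2Rep ?_
  have h := MemSobolev.laplacian (show MemSobolev 2 2 (u : Distr N) from hu)
  simpa using h

/-- On `H²`, `partialDeriv i u` really is the distributional partial derivative. -/
theorem coe_partialDeriv {N : ℕ} {u : L2 N} (hu : u ∈ H2 N) (i : Fin N) :
    (partialDeriv i u : Distr N) = ∂_{EuclideanSpace.single i (1 : ℝ)} (u : Distr N) := by
  refine coe_l2Rep ?_
  have h := MemSobolev.lineDerivOp (show MemSobolev 2 2 (u : Distr N) from hu)
    (m := EuclideanSpace.single i (1 : ℝ))
  exact h.mono (by norm_num)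

end MixedDispersion

end

/-! Completing the square with κ = β/(2γ) turns the energy plus β²c/(8γ) into γ/2 ‖(Δ+κ)u‖² minus
the power term. Both claims thus reduce to one: for every mass c and every a > 0 some Schwartz u of
mass c satisfies ‖(Δ+κ)u‖² < a ∫|u|^{2σ+2} (`exists_norm_lap_add_smul_sq_lt`).

By Plancherel the left side is ∫ (κ - 4π²|ξ|²)² |û|², which is small when û lives near the sphere
4π²|ξ|² = κ. Take û to be a multiple of a bump of measure about J. The mass constraint and the
absence of cancellation give |u|² ≳ cJ on a set F dual to the support, so the power term is ≳ |F|
J^{σ+1}.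

An annulus of width s has symbol O(s), J ~ s and F a fixed ball: s² against s^{σ+1}, which suffices
if σ < 1. A plate of thickness s² and tangential width s has symbol O(s²), J ~ s^{N+1} and |F| ~
s^{-(N+1)}: s⁴ against s^{(N+1)σ}, which suffices if σ < 4/(N+1). -/

namespace MixedDispersion
open FourierTransform Real

variable {N : ℕ}

/-! ### The functionals on Schwartz functions -/

/-- A Schwartz function, as an element of `L²(ℝᴺ)`. -/
noncomputable abbrev toL2 (f : 𝓢(EuclideanSpace ℝ (Fin N), ℂ)) : L2 N := SchwartzMap.toLp f 2 volume

theorem toL2_mem_H2 (f : 𝓢(EuclideanSpace ℝ (Fin N), ℂ)) : toL2 f ∈ H2 N := by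
  simp only [H2, Set.mem_ofPred_eq, toL2, Lp.toTemperedDistribution_toLp_eq]
  exact f.memSobolev

theorem lap_toL2 (f : 𝓢(EuclideanSpace ℝ (Fin N), ℂ)) :
    lap (toL2 f) = toL2 (Δ f) := by
  unfold lap
  rw [Lp.toTemperedDistribution_toLp_eq, laplacian_toTemperedDistributionCLM_eq,
    ← Lp.toTemperedDistribution_toLp_eq (p := 2), l2Rep_coe]

theorem partialDeriv_toL2 (i : Fin N) (f : 𝓢(EuclideanSpace ℝ (Fin N), ℂ)) :
    partialDeriv i (toL2 f) = toL2 (∂_{EuclideanSpace.single i (1 : ℝ)} f) := by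
  unfold partialDeriv
  rw [Lp.toTemperedDistribution_toLp_eq, lineDerivOp_toTemperedDistributionCLM_eq,
    ← Lp.toTemperedDistribution_toLp_eq (p := 2), l2Rep_coe]

theorem norm_toL2_sq (f : 𝓢(EuclideanSpace ℝ (Fin N), ℂ)) :
    ‖toL2 f‖ ^ 2 = ∫ x, ‖f x‖ ^ 2 := by
  rw [SchwartzMap.norm_toLp' (by simp) (by simp)]
  have h : 0 ≤ ∫ x, ‖f x‖ ^ 2 := integral_nonneg fun x ↦ by positivity
  rw [← Real.rpow_natCast, ← Real.rpow_mul (by simpa using h)]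
  simp

theorem integral_norm_sq_toL2 (f : 𝓢(EuclideanSpace ℝ (Fin N), ℂ)) :
    ∫ x, ‖toL2 f x‖ ^ 2 = ∫ x, ‖f x‖ ^ 2 := by
  apply integral_congr_ae
  filter_upwards [f.coeFn_toLp 2] with x hx
  rw [hx]

theorem powerInt_toL2 (σ : ℝ) (f : 𝓢(EuclideanSpace ℝ (Fin N), ℂ)) :
    powerInt σ (toL2 f) = ∫ x, ‖f x‖ ^ (2 * σ + 2) := by
  apply integral_congr_ae
  filter_upwards [f.coeFn_toLp 2] with x hx
  rw [hx]

/-- Integration by parts in each coordinate. -/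
theorem gradNormSq_toL2 (f : 𝓢(EuclideanSpace ℝ (Fin N), ℂ)) :
    gradNormSq (toL2 f) = -∫ x, inner ℝ (f x) (Δ f x) := by
  have key : ∀ i : Fin N, ‖partialDeriv i (toL2 f)‖ ^ 2 =
      -∫ x, inner ℝ (f x)
        (∂_{EuclideanSpace.single i (1 : ℝ)} (∂_{EuclideanSpace.single i (1 : ℝ)} f) x) := by
    intro i
    have h := SchwartzMap.integral_bilinear_lineDerivOp_right_eq_neg_left (μ := volume) f
      (∂_{EuclideanSpace.single i (1 : ℝ)} f) (innerSL ℝ) (EuclideanSpace.single i (1 : ℝ))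
    have h' : ∫ x, inner ℝ (f x) (∂_{EuclideanSpace.single i (1 : ℝ)}
        (∂_{EuclideanSpace.single i (1 : ℝ)} f) x) = -∫ x, inner ℝ
        (∂_{EuclideanSpace.single i (1 : ℝ)} f x) (∂_{EuclideanSpace.single i (1 : ℝ)} f x) := h
    rw [h', neg_neg, partialDeriv_toL2, norm_toL2_sq]
    simp only [real_inner_self_eq_norm_sq]
  unfold gradNormSq
  simp_rw [key]
  rw [Finset.sum_neg_distrib, ← integral_finsetSum]
  · congr 2 with x
    rw [SchwartzMap.laplacian_eq_sum (EuclideanSpace.basisFun (Fin N) ℝ), sum_apply,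
      inner_sum]
    simp
  · intro i _
    exact (SchwartzMap.pairing (innerSL ℝ) f _).integrable

theorem toL2_add_smul (f g : 𝓢(EuclideanSpace ℝ (Fin N), ℂ)) (κ : ℝ) :
    toL2 (f + κ • g) = toL2 f + κ • toL2 g := by
  have h1 := (SchwartzMap.toLpCLM ℝ (E := EuclideanSpace ℝ (Fin N)) ℂ 2 volume).map_add f (κ • g)
  have h2 := (SchwartzMap.toLpCLM ℝ (E := EuclideanSpace ℝ (Fin N)) ℂ 2 volume).map_smul κ g
  simp only [SchwartzMap.toLpCLM_apply] at h1 h2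
  rw [toL2, h1, h2]

theorem lap_add_smul_toL2 (f : 𝓢(EuclideanSpace ℝ (Fin N), ℂ)) (κ : ℝ) :
    lap (toL2 f) + κ • toL2 f = toL2 (Δ f + κ • f) := by
  rw [lap_toL2, toL2_add_smul]

/-- The completed square; it links the energy to the operator Δ + κ. -/
theorem norm_lap_add_smul_sq (f : 𝓢(EuclideanSpace ℝ (Fin N), ℂ)) (κ : ℝ) :
    ‖lap (toL2 f) + κ • toL2 f‖ ^ 2 =
      ‖lap (toL2 f)‖ ^ 2 - 2 * κ * gradNormSq (toL2 f) +
        κ ^ 2 * ‖toL2 f‖ ^ 2 := by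
  have hint : ∀ g h : 𝓢(EuclideanSpace ℝ (Fin N), ℂ),
      Integrable (fun x ↦ inner ℝ (g x) (h x)) := fun g h ↦
    (SchwartzMap.pairing (innerSL ℝ) g h).integrable
  rw [lap_add_smul_toL2, lap_toL2, gradNormSq_toL2, norm_toL2_sq, norm_toL2_sq, norm_toL2_sq]
  have hpt : ∀ x, ‖(Δ f + κ • f) x‖ ^ 2 =
      inner ℝ (Δ f x) (Δ f x) + 2 * κ * inner ℝ (f x) (Δ f x) + κ ^ 2 * inner ℝ (f x) (f x) := by
    intro x
    rw [add_apply, smul_apply, norm_add_sq_real, real_inner_smul_right,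
      norm_smul, real_inner_self_eq_norm_sq, real_inner_self_eq_norm_sq, mul_pow,
      real_inner_comm, Real.norm_eq_abs, sq_abs]
    ring
  simp_rw [hpt]
  have h1 : Integrable fun x ↦ inner ℝ (Δ f x) (Δ f x) + 2 * κ * inner ℝ (f x) (Δ f x) :=
    (hint _ _).add ((hint _ _).const_mul _)
  rw [integral_add h1 ((hint _ _).const_mul _),
    integral_add (hint _ _) ((hint _ _).const_mul _), integral_const_mul, integral_const_mul]
  simp_rw [real_inner_self_eq_norm_sq]
  ring

/-! ### Fourier side and bump-type test functions -/

theorem fourier_laplacian_apply (f : 𝓢(EuclideanSpace ℝ (Fin N), ℂ))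
    (ξ : EuclideanSpace ℝ (Fin N)) :
    𝓕 (Δ f) ξ = -((4 * π ^ 2 * ‖ξ‖ ^ 2 : ℝ) : ℂ) * 𝓕 f ξ := by
  rw [SchwartzMap.laplacian_eq_fourierMultiplierCLM, FourierTransform.fourier_smul,
    SchwartzMap.fourierMultiplierCLM_apply, FourierTransform.fourier_fourierInv_eq,
    smul_apply, SchwartzMap.smulLeftCLM_apply_apply (by fun_prop)]
  simp only [Complex.real_smul]
  push_cast
  ring

theorem norm_lap_add_smul_sq_eq_integral_fourier (f : 𝓢(EuclideanSpace ℝ (Fin N), ℂ)) (κ : ℝ) :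
    ‖lap (toL2 f) + κ • toL2 f‖ ^ 2 =
      ∫ ξ, (κ - 4 * π ^ 2 * ‖ξ‖ ^ 2) ^ 2 * ‖𝓕 f ξ‖ ^ 2 := by
  rw [lap_add_smul_toL2, norm_toL2_sq, ← SchwartzMap.integral_norm_sq_fourier]
  congr 1 with ξ
  have hκ : κ • f = (κ : ℂ) • f := by ext; simp
  rw [FourierTransform.fourier_add, hκ, FourierTransform.fourier_smul, add_apply,
    smul_apply, fourier_laplacian_apply, smul_eq_mul, ← add_mul, norm_mul, mul_pow,
    ← Complex.ofReal_neg, ← Complex.ofReal_add, Complex.norm_real, Real.norm_eq_abs, sq_abs]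
  ring

/-- There is no cancellation: after removing the unimodular factor of frequency ξ₀, every phase θ on
the support has |θ| ≤ 1, and cos θ ≥ 1 - θ²/2 ≥ 1/2. -/
theorem half_integral_le_norm_fourierInv (f g : 𝓢(EuclideanSpace ℝ (Fin N), ℂ))
    (hfg : f = 𝓕⁻ g) (ψ : EuclideanSpace ℝ (Fin N) → ℝ) (hg : ∀ ξ, g ξ = ψ ξ) (h0 : ∀ ξ, 0 ≤ ψ ξ)
    (ξ₀ x : EuclideanSpace ℝ (Fin N))
    (hx : ∀ ξ, ψ ξ ≠ 0 → |2 * π * inner ℝ (ξ - ξ₀) x| ≤ 1) :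
    (∫ ξ, ψ ξ) / 2 ≤ ‖f x‖ := by
  have hint : Integrable ψ := by
    refine g.integrable.re.congr (.of_forall fun ξ ↦ ?_)
    simp [hg]
  set θ : EuclideanSpace ℝ (Fin N) → ℝ := fun ξ ↦ 2 * π * inner ℝ (ξ - ξ₀) x
  set z : ℂ := Complex.exp (-(2 * π * inner ℝ ξ₀ x : ℝ) * Complex.I)
  have hz : ‖z‖ = 1 := by
    simp only [z]
    rw [← Complex.ofReal_neg]; exact Complex.norm_exp_ofReal_mul_I _
  have hf : z * f x = ∫ ξ, Complex.exp (θ ξ * Complex.I) * ψ ξ := by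
    rw [hfg, SchwartzMap.fourierInv_coe, Real.fourierInv_eq', ← integral_const_mul]
    congr 1 with ξ
    rw [hg, smul_eq_mul, ← mul_assoc, ← Complex.exp_add]
    congr 2
    simp only [θ, inner_sub_left]
    push_cast
    ring
  have hcont : Continuous θ := by fun_prop
  have hint2 : Integrable fun ξ ↦ Complex.exp (θ ξ * Complex.I) * ψ ξ := by
    refine hint.ofReal.bdd_mul (c := 1) (by fun_prop) (.of_forall fun ξ ↦ ?_)
    rw [Complex.norm_exp_ofReal_mul_I]
  have hre : (z * f x).re = ∫ ξ, Real.cos (θ ξ) * ψ ξ := by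
    rw [hf]
    have := integral_re (𝕜 := ℂ) hint2
    simp only [RCLike.re_to_complex, Complex.re_mul_ofReal, Complex.exp_ofReal_mul_I_re] at this
    exact this.symm
  calc (∫ ξ, ψ ξ) / 2 = ∫ ξ, 1 / 2 * ψ ξ := by rw [integral_const_mul]; ring
    _ ≤ ∫ ξ, Real.cos (θ ξ) * ψ ξ := by
      refine integral_mono (hint.const_mul _) ?_ fun ξ ↦ ?_
      · refine hint.bdd_mul (c := 1) (by fun_prop) (.of_forall fun ξ ↦ ?_)
        exact Real.abs_cos_le_one _
      · by_cases h : ψ ξ = 0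
        · simp [h]
        · refine mul_le_mul_of_nonneg_right ?_ (h0 ξ)
          have h2 : θ ξ ^ 2 ≤ 1 := (sq_le_one_iff_abs_le_one _).2 (hx ξ h)
          linarith [Real.one_sub_sq_div_two_le_cos (x := θ ξ)]
    _ = (z * f x).re := hre.symm
    _ ≤ ‖z * f x‖ := Complex.re_le_norm _
    _ = ‖f x‖ := by rw [norm_mul, hz, one_mul]

/-- Test functions whose Fourier transform is a multiple of a prescribed bump function `ψ`. -/
theorem exists_schwartz_of_bump {σ κ η c I : ℝ} (hσ : 0 < σ) (hc : 0 < c) (hI : 0 < I)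
    {ψ : EuclideanSpace ℝ (Fin N) → ℝ} (hψ : ContDiff ℝ (⊤ : ℕ∞) ψ) (hsupp : HasCompactSupport ψ)
    (h0 : ∀ ξ, 0 ≤ ψ ξ) (h1 : ∀ ξ, ψ ξ ≤ 1) (hIψ : I ≤ ∫ ξ, ψ ξ ^ 2)
    (hη : ∀ ξ, ψ ξ ≠ 0 → |κ - 4 * π ^ 2 * ‖ξ‖ ^ 2| ≤ η)
    {F : Set (EuclideanSpace ℝ (Fin N))} (hF : MeasurableSet F)
    (ξ₀ : EuclideanSpace ℝ (Fin N))
    (hx : ∀ x ∈ F, ∀ ξ, ψ ξ ≠ 0 → |2 * π * inner ℝ (ξ - ξ₀) x| ≤ 1) :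
    ∃ f : 𝓢(EuclideanSpace ℝ (Fin N), ℂ), toL2 f ∈ S N c ∧
      ‖lap (toL2 f) + κ • toL2 f‖ ^ 2 ≤ η ^ 2 * c ∧
      volume.real F * (c * I / 4) ^ (σ + 1) ≤ powerInt σ (toL2 f) := by
  set J := ∫ ξ, ψ ξ ^ 2 with hJ
  -- The amplitude A below is fixed by the mass constraint A²J = c.
  have hJpos : 0 < J := hI.trans_le hIψ
  set A := √(c / J) with hA
  have hApos : 0 < A := Real.sqrt_pos.2 (by positivity)
  have hA2 : A ^ 2 * J = c := by
    rw [hA, Real.sq_sqrt (by positivity)]; field_simp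
  have hint : Integrable ψ := hψ.continuous.integrable_of_hasCompactSupport hsupp
  have hint2 : Integrable fun ξ ↦ ψ ξ ^ 2 := by
    refine (hψ.continuous.pow 2).integrable_of_hasCompactSupport ?_
    exact hsupp.mono fun ξ hξ h ↦ hξ (by simp [h])
  have hgs : HasCompactSupport fun ξ ↦ ((A * ψ ξ : ℝ) : ℂ) :=
    hsupp.mono fun ξ hξ h ↦ hξ (by simp [h])
  have hgc : ContDiff ℝ (⊤ : ℕ∞) fun ξ ↦ ((A * ψ ξ : ℝ) : ℂ) :=
    Complex.ofRealCLM.contDiff.comp (contDiff_const.mul hψ)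
  obtain ⟨g, hg⟩ : ∃ g : 𝓢(EuclideanSpace ℝ (Fin N), ℂ), ∀ ξ, g ξ = ((A * ψ ξ : ℝ) : ℂ) :=
    ⟨hgs.toSchwartzMap hgc, fun ξ ↦ rfl⟩
  have hgn : ∀ ξ, ‖g ξ‖ ^ 2 = A ^ 2 * ψ ξ ^ 2 := by
    intro ξ
    rw [hg, Complex.norm_real, Real.norm_eq_abs, sq_abs, mul_pow]
  obtain ⟨f, hff⟩ : ∃ f : 𝓢(EuclideanSpace ℝ (Fin N), ℂ), f = 𝓕⁻ g := ⟨_, rfl⟩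
  have hFf : 𝓕 f = g := hff ▸ FourierTransform.fourier_fourierInv_eq g
  refine ⟨f, ⟨toL2_mem_H2 f, ?_⟩, ?_, ?_⟩
  · rw [integral_norm_sq_toL2, ← SchwartzMap.integral_norm_sq_fourier, hFf]
    simp_rw [hgn]
    rw [integral_const_mul, hA2]
  · rw [norm_lap_add_smul_sq_eq_integral_fourier, hFf]
    have h : η ^ 2 * c = ∫ ξ, η ^ 2 * (A ^ 2 * ψ ξ ^ 2) := by
      rw [integral_const_mul, integral_const_mul, hA2]
    rw [h]
    refine integral_mono_of_nonneg (.of_forall fun ξ ↦ by positivity)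
      ((hint2.const_mul _).const_mul _) (.of_forall fun ξ ↦ ?_)
    simp only [hgn]
    by_cases hz : ψ ξ = 0
    · simp [hz]
    · refine mul_le_mul_of_nonneg_right ?_ (by positivity)
      rw [← sq_abs]
      exact pow_le_pow_left₀ (abs_nonneg _) (hη ξ hz) 2
  · rw [powerInt_toL2]
    have hlow : ∀ x ∈ F, (c * I / 4) ^ (σ + 1) ≤ ‖f x‖ ^ (2 * σ + 2) := by
      intro x hxF
      have hb := half_integral_le_norm_fourierInv f g hff (fun ξ ↦ A * ψ ξ) hg
        (fun ξ ↦ mul_nonneg hApos.le (h0 ξ)) ξ₀ x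
        (fun ξ hξ ↦ hx x hxF ξ (right_ne_zero_of_mul hξ))
      rw [integral_const_mul] at hb
      -- Since 0 ≤ ψ ≤ 1, ψ² ≤ ψ; hence |f| ≥ AJ/2 on F, and (AJ/2)² = cJ/4.
      have hJle : J ≤ ∫ ξ, ψ ξ := integral_mono hint2 hint fun ξ ↦ by
        nlinarith [h0 ξ, h1 ξ]
      have hb2 : A * J / 2 ≤ ‖f x‖ := le_trans (by gcongr) hb
      have hb3 : c * I / 4 ≤ ‖f x‖ ^ 2 := by
        calc c * I / 4 ≤ c * J / 4 := by gcongr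
          _ = (A * J / 2) ^ 2 := by rw [← hA2]; ring
          _ ≤ _ := pow_le_pow_left₀ (by positivity) hb2 2
      calc (c * I / 4) ^ (σ + 1) ≤ (‖f x‖ ^ 2) ^ (σ + 1) :=
            Real.rpow_le_rpow (by positivity) hb3 (by positivity)
        _ = ‖f x‖ ^ (2 * σ + 2) := by
            rw [← Real.rpow_natCast, ← Real.rpow_mul (norm_nonneg _)]
            congr 1; push_cast; ring
    have hfint : Integrable fun x ↦ ‖f x‖ ^ (2 * σ + 2) := by
      have hm := f.memLp (ENNReal.ofReal (2 * σ + 2)) volume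
      have := hm.integrable_norm_rpow (by simp; positivity) (by simp)
      rwa [ENNReal.toReal_ofReal (by positivity)] at this
    calc volume.real F * (c * I / 4) ^ (σ + 1)
        = ∫ x in F, (c * I / 4) ^ (σ + 1) := by rw [setIntegral_const, smul_eq_mul]
      _ ≤ ∫ x in F, ‖f x‖ ^ (2 * σ + 2) := by
          -- If F has infinite measure, its real-valued measure is 0 and the bound is trivial.
          by_cases hFt : volume F = ⊤
          · rw [setIntegral_const, measureReal_def, hFt]
            simp only [ENNReal.toReal_top, zero_smul]
            exact integral_nonneg fun x ↦ by positivity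
          · exact setIntegral_mono_on (integrableOn_const hFt) hfint.integrableOn hF hlow
      _ ≤ ∫ x, ‖f x‖ ^ (2 * σ + 2) :=
          setIntegral_le_integral hfint (.of_forall fun x ↦ by positivity)

/-! ### Annular family -/

/-- The bump function on the line that is `1` on `[-1, 1]` and supported in `[-2, 2]`. -/
noncomputable def lineBump : ContDiffBump (0 : ℝ) where
  rIn := 1
  rOut := 2
  rIn_pos := one_pos
  rIn_lt_rOut := one_lt_two

theorem lineBump_eq_one {t : ℝ} (ht : |t| ≤ 1) : lineBump t = 1 :=
  lineBump.one_of_mem_closedBall (by simpa [lineBump] using ht)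

theorem abs_le_two_of_lineBump_ne_zero {t : ℝ} (ht : lineBump t ≠ 0) : |t| ≤ 2 := by
  by_contra! h
  exact ht (lineBump.zero_of_le_dist (by simpa [lineBump] using h.le))

theorem measureReal_le_integral_sq {α : Type*} [MeasurableSpace α] {μ : Measure α} {ψ : α → ℝ}
    (hint : Integrable (fun x ↦ ψ x ^ 2) μ) {E : Set α} (hE : MeasurableSet E) (hEt : μ E ≠ ⊤)
    (h1 : ∀ x ∈ E, ψ x = 1) : μ.real E ≤ ∫ x, ψ x ^ 2 ∂μ := by
  calc μ.real E = ∫ x in E, (1 : ℝ) ∂μ := by simp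
    _ ≤ ∫ x in E, ψ x ^ 2 ∂μ :=
      setIntegral_mono_on (integrableOn_const hEt) hint.integrableOn hE
        fun x hx ↦ by simp [h1 x hx]
    _ ≤ ∫ x, ψ x ^ 2 ∂μ := setIntegral_le_integral hint (.of_forall fun x ↦ by positivity)

theorem integrable_sq_of_hasCompactSupport {ψ : EuclideanSpace ℝ (Fin N) → ℝ} (hc : Continuous ψ)
    (hs : HasCompactSupport ψ) : Integrable fun ξ ↦ ψ ξ ^ 2 :=
  (hc.pow 2).integrable_of_hasCompactSupport (hs.mono fun ξ hξ h ↦ hξ (by simp [h]))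

/-- Bernoulli's inequality: (1+s)^N - 1 ≥ Ns ≥ s. -/
theorem le_measureReal_annulus (hN : 1 ≤ N) {r s : ℝ} (hr : 0 < r) (hs : 0 < s) :
    volume.real (Metric.ball (0 : EuclideanSpace ℝ (Fin N)) 1) * r ^ N * s ≤
      volume.real (Metric.closedBall (0 : EuclideanSpace ℝ (Fin N)) (r * (1 + s)) \
        Metric.closedBall 0 r) := by
  have hball : ∀ t : ℝ, 0 ≤ t → volume.real (Metric.closedBall (0 : EuclideanSpace ℝ (Fin N)) t) =
      t ^ N * volume.real (Metric.ball (0 : EuclideanSpace ℝ (Fin N)) 1) := by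
    intro t ht
    rw [measureReal_def, Measure.addHaar_closedBall _ _ ht, finrank_euclideanSpace_fin,
      ENNReal.toReal_mul, ENNReal.toReal_ofReal (by positivity), measureReal_def]
  rw [measureReal_sdiff (Metric.closedBall_subset_closedBall (by nlinarith))
    Metric.isClosed_closedBall.measurableSet measure_closedBall_lt_top.ne,
    hball _ (by positivity), hball _ hr.le, mul_pow]
  have hbern := one_add_mul_le_pow (a := s) (by linarith) N
  have hN' : (1 : ℝ) ≤ N := by exact_mod_cast hN
  have h1 : s ≤ (1 + s) ^ N - 1 := by nlinarith
  have h2 : 0 ≤ volume.real (Metric.ball (0 : EuclideanSpace ℝ (Fin N)) 1) * r ^ N := by positivity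
  nlinarith [mul_le_mul_of_nonneg_left h1 h2]

/-- Functions with Fourier support in a thin annulus around the sphere `4π²|ξ|² = κ`. -/
theorem exists_annular_family (hN : 1 ≤ N) {σ κ c : ℝ} (hσ : 0 < σ) (hκ : 0 < κ) (hc : 0 < c) :
    ∃ K C : ℝ, 0 < K ∧ 0 < C ∧ ∀ s : ℝ, 0 < s → s ≤ 1 →
      ∃ f : 𝓢(EuclideanSpace ℝ (Fin N), ℂ), toL2 f ∈ S N c ∧
        ‖lap (toL2 f) + κ • toL2 f‖ ^ 2 ≤ K * s ^ (2 : ℝ) ∧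
        C * s ^ (σ + 1) ≤ powerInt σ (toL2 f) := by
  set V := volume.real (Metric.ball (0 : EuclideanSpace ℝ (Fin N)) 1) with hV
  have hVpos : 0 < V :=
    ENNReal.toReal_pos (Metric.measure_ball_pos _ _ one_pos).ne' measure_ball_lt_top.ne
  set r := √κ / (2 * π) with hr
  have hrpos : 0 < r := by positivity
  have hr2 : 4 * π ^ 2 * r ^ 2 = κ := by
    rw [hr, div_pow, Real.sq_sqrt hκ.le]; field_simp; ring
  set δ := 1 / (2 * π * (3 * r)) with hδ
  have hδpos : 0 < δ := by positivity
  set VF := volume.real (Metric.closedBall (0 : EuclideanSpace ℝ (Fin N)) δ)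
  have hVF : 0 < VF :=
    ENNReal.toReal_pos (Metric.measure_closedBall_pos _ _ hδpos).ne' measure_closedBall_lt_top.ne
  refine ⟨36 * κ ^ 2 * c, VF * (c * (V * r ^ N) / 4) ^ (σ + 1), by positivity, by positivity,
    fun s hs hs1 ↦ ?_⟩
  -- The scale 3κs makes ψ = 1 on the shell r < |ξ| ≤ r(1+s), where 4π²|ξ|² - κ ≤ κ(2s+s²) ≤ 3κs.
  set ψ : EuclideanSpace ℝ (Fin N) → ℝ := fun ξ ↦
    lineBump ((4 * π ^ 2 * ‖ξ‖ ^ 2 - κ) / (3 * κ * s)) with hψ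
  have hψc : ContDiff ℝ (⊤ : ℕ∞) ψ :=
    lineBump.contDiff.comp
      (((contDiff_const.mul (contDiff_norm_sq ℝ)).sub contDiff_const).div_const _)
  have hη : ∀ ξ, ψ ξ ≠ 0 → |κ - 4 * π ^ 2 * ‖ξ‖ ^ 2| ≤ 6 * κ * s := by
    intro ξ hξ
    have h := abs_le_two_of_lineBump_ne_zero hξ
    rw [abs_div, abs_of_pos (show 0 < 3 * κ * s by positivity), div_le_iff₀ (by positivity)] at h
    rw [abs_sub_comm]
    linarith
  -- On the support 4π²|ξ|² ≤ κ + 6κs ≤ 7κ < 9κ = 4π²(3r)².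
  have hR : ∀ ξ, ψ ξ ≠ 0 → ‖ξ‖ ≤ 3 * r := by
    intro ξ hξ
    have h := (abs_le.1 (hη ξ hξ)).1
    have h2 : κ * s ≤ κ := by nlinarith
    refine le_of_sq_le_sq ?_ (by positivity)
    refine le_of_mul_le_mul_left (a := 4 * π ^ 2) ?_ (by positivity)
    nlinarith
  have hψs : HasCompactSupport ψ := by
    refine HasCompactSupport.intro (isCompact_closedBall 0 (3 * r)) fun ξ hξ ↦ ?_
    by_contra h
    exact hξ (by simpa using hR ξ h)
  have hI : V * r ^ N * s ≤ ∫ ξ, ψ ξ ^ 2 := by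
    refine (le_measureReal_annulus hN hrpos hs).trans (measureReal_le_integral_sq
      (integrable_sq_of_hasCompactSupport hψc.continuous hψs)
      (Metric.isClosed_closedBall.measurableSet.diff Metric.isClosed_closedBall.measurableSet)
      (measure_ne_top_of_subset Set.sdiff_subset measure_closedBall_lt_top.ne) fun ξ hξ ↦ ?_)
    obtain ⟨h1, h2⟩ := hξ
    simp only [Metric.mem_closedBall, dist_zero_right, not_le] at h1 h2
    apply lineBump_eq_one
    have h3 : r ^ 2 ≤ ‖ξ‖ ^ 2 := pow_le_pow_left₀ hrpos.le h2.le 2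
    have h4 : ‖ξ‖ ^ 2 ≤ (r * (1 + s)) ^ 2 := pow_le_pow_left₀ (norm_nonneg _) h1 2
    have hπ : 0 < 4 * π ^ 2 := by positivity
    have h5 : κ ≤ 4 * π ^ 2 * ‖ξ‖ ^ 2 := hr2 ▸ mul_le_mul_of_nonneg_left h3 hπ.le
    have h6 : 4 * π ^ 2 * ‖ξ‖ ^ 2 ≤ κ * (1 + s) ^ 2 := by
      rw [← hr2, mul_assoc _ (r ^ 2), ← mul_pow]; exact mul_le_mul_of_nonneg_left h4 hπ.le
    have h7 : κ * s ^ 2 ≤ κ * s := by gcongr; nlinarith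
    rw [abs_of_nonneg (div_nonneg (by linarith) (by positivity)), div_le_one (by positivity)]
    nlinarith
  obtain ⟨f, hf1, hf2, hf3⟩ := exists_schwartz_of_bump (I := V * r ^ N * s) hσ hc (by positivity)
    hψc hψs (fun ξ ↦ lineBump.nonneg) (fun ξ ↦ lineBump.le_one) hI hη
    (F := Metric.closedBall 0 δ) Metric.isClosed_closedBall.measurableSet 0 (by
      intro x hx ξ hξ
      rw [mem_closedBall_zero_iff] at hx
      rw [sub_zero, abs_mul, abs_of_pos (by positivity : 0 < 2 * π)]
      calc 2 * π * |inner ℝ ξ x| ≤ 2 * π * (3 * r * δ) := by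
            gcongr
            exact (abs_real_inner_le_norm ξ x).trans (by gcongr; exact hR ξ hξ)
        _ = 1 := by rw [hδ]; field_simp)
  refine ⟨f, hf1, hf2.trans (le_of_eq ?_), le_trans (le_of_eq ?_) hf3⟩
  · rw [Real.rpow_two]; ring
  · rw [mul_assoc, ← Real.mul_rpow (by positivity) hs.le]
    congr 2; ring

/-! ### Boxes and the plate family -/

theorem measurableSet_box (a r : Fin N → ℝ) :
    MeasurableSet {x : EuclideanSpace ℝ (Fin N) | ∀ i, |x i - a i| ≤ r i} := by
  simp only [Set.ofPred_forall]
  refine MeasurableSet.iInter fun i ↦ (isClosed_le ?_ continuous_const).measurableSet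
  fun_prop

theorem volume_box (a r : Fin N → ℝ) :
    volume {x : EuclideanSpace ℝ (Fin N) | ∀ i, |x i - a i| ≤ r i} =
      ∏ i, ENNReal.ofReal (2 * r i) := by
  have h : {x : EuclideanSpace ℝ (Fin N) | ∀ i, |x i - a i| ≤ r i} =
      WithLp.ofLp ⁻¹' Set.Icc (fun i ↦ a i - r i) (fun i ↦ a i + r i) := by
    ext x
    simp only [Set.mem_ofPred_eq, Set.mem_preimage, Set.mem_Icc, Pi.le_def, abs_le, ← forall_and]
    refine forall_congr' fun i ↦ ⟨fun h ↦ ⟨?_, ?_⟩, fun h ↦ ⟨?_, ?_⟩⟩ <;> linarith [h.1, h.2]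
  rw [h, (PiLp.volume_preserving_ofLp (Fin N)).measure_preimage
    measurableSet_Icc.nullMeasurableSet, Real.volume_Icc_pi]
  refine Finset.prod_congr rfl fun i _ ↦ ?_
  congr 1; ring

theorem measureReal_box (a : Fin N → ℝ) {r : Fin N → ℝ} (hr : ∀ i, 0 ≤ r i) :
    volume.real {x : EuclideanSpace ℝ (Fin N) | ∀ i, |x i - a i| ≤ r i} = ∏ i, 2 * r i := by
  rw [measureReal_def, volume_box, ENNReal.toReal_prod]
  refine Finset.prod_congr rfl fun i _ ↦ ENNReal.toReal_ofReal ?_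
  have := hr i
  positivity

/-- Functions with Fourier support in a small plate that touches the sphere `4π²|ξ|² = κ`. -/
theorem exists_plate_family (hN : 1 ≤ N) {σ κ c : ℝ} (hσ : 0 < σ) (hκ : 0 < κ) (hc : 0 < c) :
    ∃ K C : ℝ, 0 < K ∧ 0 < C ∧ ∀ s : ℝ, 0 < s → s ≤ 1 →
      ∃ f : 𝓢(EuclideanSpace ℝ (Fin N), ℂ), toL2 f ∈ S N c ∧
        ‖lap (toL2 f) + κ • toL2 f‖ ^ 2 ≤ K * s ^ (4 : ℝ) ∧
        C * s ^ (((N : ℝ) + 1) * σ) ≤ powerInt σ (toL2 f) := by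
  set r := √κ / (2 * π) with hr
  have hrpos : 0 < r := by positivity
  have hr2 : 4 * π ^ 2 * r ^ 2 = κ := by
    rw [hr, div_pow, Real.sq_sqrt hκ.le]; field_simp; ring
  have hNpos : (0 : ℝ) < N := by exact_mod_cast hN
  set δ := 1 / (4 * π * N) with hδ
  have hδpos : 0 < δ := by positivity
  -- The 4r bounds the linear term 2r·2s² and the 4N the quadratic term N(2s)² in |ξ|² - r².
  set L := 4 * π ^ 2 * (4 * r + 4 * N) with hL
  have hLpos : 0 < L := by positivity
  refine ⟨L ^ 2 * c, (2 * δ) ^ N * (c * 2 ^ N / 4) ^ (σ + 1), by positivity, by positivity,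
    fun s hs hs1 ↦ ?_⟩
  set i₀ : Fin N := ⟨0, hN⟩
  -- Direction i₀ is normal to the sphere at ξ₀. Over a tangential width s the sphere bends by
  -- O(s²), so thickness s² keeps the symbol O(s²).
  set d : Fin N → ℝ := fun i ↦ if i = i₀ then s ^ 2 else s with hd
  have hdpos : ∀ i, 0 < d i := fun i ↦ by simp only [hd]; split_ifs <;> positivity
  have hdle : ∀ i, d i ≤ s := fun i ↦ by simp only [hd]; split_ifs <;> nlinarith
  have hprod : ∏ i, d i = s ^ (N + 1) := by
    rw [← Finset.mul_prod_erase _ _ (Finset.mem_univ i₀),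
      Finset.prod_congr rfl (g := fun _ ↦ s) (fun i hi ↦ by simp [hd, Finset.ne_of_mem_erase hi]),
      Finset.prod_const, Finset.card_erase_of_mem (Finset.mem_univ _), Finset.card_univ,
      Fintype.card_fin]
    simp only [hd, if_true]
    rw [← pow_add]; congr 1; omega
  set ξ₀ : EuclideanSpace ℝ (Fin N) := EuclideanSpace.single i₀ r with hξ₀
  set ψ : EuclideanSpace ℝ (Fin N) → ℝ := fun ξ ↦ ∏ i, lineBump ((ξ i - ξ₀ i) / d i) with hψ
  have hψc : ContDiff ℝ (⊤ : ℕ∞) ψ := by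
    refine contDiff_prod fun i _ ↦ lineBump.contDiff.comp ?_
    exact ((EuclideanSpace.proj i : EuclideanSpace ℝ (Fin N) →L[ℝ] ℝ).contDiff.sub
      contDiff_const).div_const _
  have hh : ∀ ξ, ψ ξ ≠ 0 → ∀ i, |ξ i - ξ₀ i| ≤ 2 * d i := by
    intro ξ hξ i
    have h := abs_le_two_of_lineBump_ne_zero (Finset.prod_ne_zero_iff.1 hξ i (Finset.mem_univ i))
    rwa [abs_div, abs_of_pos (hdpos i), div_le_iff₀ (hdpos i)] at h
  have hnorm : ∀ ξ, ψ ξ ≠ 0 → ‖ξ - ξ₀‖ ^ 2 ≤ N * (4 * s ^ 2) := by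
    intro ξ hξ
    rw [EuclideanSpace.norm_sq_eq]
    calc ∑ i, ‖(ξ - ξ₀) i‖ ^ 2 ≤ ∑ _i : Fin N, 4 * s ^ 2 := by
          refine Finset.sum_le_sum fun i _ ↦ ?_
          have h1 : ‖(ξ - ξ₀) i‖ ≤ 2 * s := (hh ξ hξ i).trans (by linarith [hdle i])
          calc _ ≤ (2 * s) ^ 2 := pow_le_pow_left₀ (norm_nonneg _) h1 2
            _ = _ := by ring
      _ = _ := by simp
  have hη : ∀ ξ, ψ ξ ≠ 0 → |κ - 4 * π ^ 2 * ‖ξ‖ ^ 2| ≤ L * s ^ 2 := by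
    intro ξ hξ
    have h0 : ‖ξ‖ ^ 2 = r ^ 2 + 2 * (r * (ξ i₀ - ξ₀ i₀)) + ‖ξ - ξ₀‖ ^ 2 := by
      have h := norm_add_sq_real ξ₀ (ξ - ξ₀)
      rw [add_sub_cancel] at h
      rw [h]
      simp [hξ₀, EuclideanSpace.inner_single_left, abs_of_pos hrpos]
    have h1 := abs_le.1 (hh ξ hξ i₀)
    have h2 : d i₀ = s ^ 2 := by simp [hd]
    have h3 := hnorm ξ hξ
    rw [h2] at h1
    have h4 : |2 * (r * (ξ i₀ - ξ₀ i₀)) + ‖ξ - ξ₀‖ ^ 2| ≤ (4 * r + 4 * N) * s ^ 2 := by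
      have h5 := mul_le_mul_of_nonneg_left h1.1 hrpos.le
      have h6 := mul_le_mul_of_nonneg_left h1.2 hrpos.le
      have h7 : 0 ≤ N * (4 * s ^ 2) := by positivity
      rw [abs_le]
      constructor <;> nlinarith [sq_nonneg ‖ξ - ξ₀‖]
    rw [h0, ← hr2, abs_sub_comm]
    calc _ = 4 * π ^ 2 * |2 * (r * (ξ i₀ - ξ₀ i₀)) + ‖ξ - ξ₀‖ ^ 2| := by
          rw [← abs_of_pos (by positivity : 0 < 4 * π ^ 2), ← abs_mul,
            abs_of_pos (by positivity : 0 < 4 * π ^ 2)]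
          congr 1; ring
      _ ≤ _ := by rw [hL, mul_assoc _ (4 * r + 4 * N)]; gcongr
  have hψs : HasCompactSupport ψ := by
    refine HasCompactSupport.intro (isCompact_closedBall ξ₀ √(N * (4 * s ^ 2))) fun ξ hξ ↦ ?_
    by_contra h
    refine hξ ?_
    rw [Metric.mem_closedBall, dist_eq_norm]
    exact Real.le_sqrt_of_sq_le (hnorm ξ h)
  have hI : 2 ^ N * s ^ (N + 1) ≤ ∫ ξ, ψ ξ ^ 2 := by
    have hvol : volume.real {ξ : EuclideanSpace ℝ (Fin N) | ∀ i, |ξ i - ξ₀ i| ≤ d i} =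
        2 ^ N * s ^ (N + 1) := by
      rw [measureReal_box _ fun i ↦ (hdpos i).le, Finset.prod_mul_distrib, hprod]
      simp
    rw [← hvol]
    refine measureReal_le_integral_sq (integrable_sq_of_hasCompactSupport hψc.continuous hψs)
      (measurableSet_box _ _) ?_ fun ξ hξ ↦ ?_
    · rw [volume_box]; exact ENNReal.prod_ne_top fun i _ ↦ ENNReal.ofReal_ne_top
    · refine Finset.prod_eq_one fun i _ ↦ lineBump_eq_one ?_
      rw [abs_div, abs_of_pos (hdpos i), div_le_one (hdpos i)]
      exact hξ i
  obtain ⟨f, hf1, hf2, hf3⟩ := exists_schwartz_of_bump (I := 2 ^ N * s ^ (N + 1)) hσ hc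
    (by positivity) hψc hψs (fun ξ ↦ Finset.prod_nonneg fun i _ ↦ lineBump.nonneg)
    (fun ξ ↦ Finset.prod_le_one (fun i _ ↦ lineBump.nonneg) fun i _ ↦ lineBump.le_one) hI hη
    -- The dual box has sides inverse to those of the plate; each coordinate contributes at most 2δ
    -- to the inner product, and 2π·N·2δ = 1.
    (measurableSet_box (fun _ ↦ 0) fun i ↦ δ / d i) ξ₀ (by
      intro x hx ξ hξ
      have h : |inner ℝ (ξ - ξ₀) x| ≤ N * (2 * δ) := by
        rw [PiLp.inner_apply]
        refine (Finset.abs_sum_le_sum_abs _ _).trans ?_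
        calc _ ≤ ∑ _i : Fin N, 2 * δ := by
              refine Finset.sum_le_sum fun i _ ↦ ?_
              have h1 := hh ξ hξ i
              have h2 : |x i| ≤ δ / d i := by simpa using hx i
              have h3 : inner ℝ ((ξ - ξ₀) i) (x i) = x i * (ξ i - ξ₀ i) := rfl
              rw [h3, abs_mul]
              calc _ ≤ δ / d i * (2 * d i) := by gcongr
                _ = 2 * δ := by have := (hdpos i).ne'; field_simp
          _ = _ := by simp
      rw [abs_mul, abs_of_pos (by positivity : 0 < 2 * π)]
      calc _ ≤ 2 * π * (N * (2 * δ)) := by gcongr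
        _ = 1 := by rw [hδ]; field_simp; norm_num)
  refine ⟨f, hf1, hf2.trans (le_of_eq ?_), le_trans (le_of_eq ?_) hf3⟩
  · rw [show (4 : ℝ) = ((4 : ℕ) : ℝ) by norm_num, Real.rpow_natCast]; ring
  · rw [measureReal_box _ fun i ↦ (div_pos hδpos (hdpos i)).le]
    have h1 : ∏ i, 2 * (δ / d i) = (2 * δ) ^ N / s ^ (N + 1) := by
      calc ∏ i, 2 * (δ / d i) = ∏ i, 2 * δ / d i := Finset.prod_congr rfl fun i _ ↦ by ring
        _ = (2 * δ) ^ N / s ^ (N + 1) := by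
          rw [Finset.prod_div_distrib, hprod, Finset.prod_const, Finset.card_fin]
    have h2 : c * (2 ^ N * s ^ (N + 1)) / 4 = c * 2 ^ N / 4 * s ^ ((N : ℝ) + 1) := by
      rw [← Nat.cast_add_one, Real.rpow_natCast]; ring
    -- The factor s^{N+1} split off here cancels against the volume of the dual box.
    have h3 : s ^ (((N : ℝ) + 1) * (σ + 1)) = s ^ (((N : ℝ) + 1) * σ) * s ^ (N + 1) := by
      rw [← Real.rpow_natCast s (N + 1), ← Real.rpow_add hs]; congr 1; push_cast; ring
    rw [h1, h2, Real.mul_rpow (by positivity) (by positivity), ← Real.rpow_mul hs.le, h3]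
    field_simp

/-! ### Comparison of exponents and conclusion -/

theorem exists_mul_rpow_lt {K C p q : ℝ} (hK : 0 < K) (hC : 0 < C) (hpq : q < p) :
    ∃ s : ℝ, 0 < s ∧ s ≤ 1 ∧ K * s ^ p < C * s ^ q := by
  have hpq' : 0 < p - q := sub_pos.2 hpq
  set t := (C / (2 * K)) ^ (p - q)⁻¹
  have ht : 0 < t := by positivity
  refine ⟨min 1 t, lt_min one_pos ht, min_le_left _ _, ?_⟩
  set s := min 1 t
  have hs : 0 < s := lt_min one_pos ht
  have h1 : s ^ (p - q) ≤ C / (2 * K) := by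
    refine (Real.rpow_le_rpow hs.le (min_le_right 1 t) hpq'.le).trans (le_of_eq ?_)
    rw [← Real.rpow_mul (by positivity), inv_mul_cancel₀ hpq'.ne', Real.rpow_one]
  have h2 : s ^ p = s ^ (p - q) * s ^ q := by rw [← Real.rpow_add hs]; congr 1; ring
  rw [h2, ← mul_assoc]
  refine mul_lt_mul_of_pos_right ?_ (by positivity)
  calc K * s ^ (p - q) ≤ K * (C / (2 * K)) := by gcongr
    _ = C / 2 := by field_simp
    _ < C := by linarith

theorem exists_norm_lap_add_smul_sq_lt (hN : 1 ≤ N) {σ κ c a : ℝ} (hσ : 0 < σ)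
    (hσmax : σ < max (4 / ((N : ℝ) + 1)) 1) (hκ : 0 < κ) (hc : 0 < c) (ha : 0 < a) :
    ∃ f : 𝓢(EuclideanSpace ℝ (Fin N), ℂ), toL2 f ∈ S N c ∧
      ‖lap (toL2 f) + κ • toL2 f‖ ^ 2 < a * powerInt σ (toL2 f) := by
  obtain ⟨p, q, hqp, K, C, hK, hC, h⟩ : ∃ p q : ℝ, q < p ∧ ∃ K C : ℝ, 0 < K ∧ 0 < C ∧
      ∀ s : ℝ, 0 < s → s ≤ 1 → ∃ f : 𝓢(EuclideanSpace ℝ (Fin N), ℂ), toL2 f ∈ S N c ∧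
        ‖lap (toL2 f) + κ • toL2 f‖ ^ 2 ≤ K * s ^ p ∧ C * s ^ q ≤ powerInt σ (toL2 f) := by
    rcases lt_max_iff.1 hσmax with h | h
    · refine ⟨4, ((N : ℝ) + 1) * σ, ?_, exists_plate_family hN hσ hκ hc⟩
      rwa [lt_div_iff₀' (by positivity)] at h
    · exact ⟨2, σ + 1, by linarith, exists_annular_family hN hσ hκ hc⟩
  obtain ⟨s, hs, hs1, hlt⟩ := exists_mul_rpow_lt hK (mul_pos ha hC) hqp
  obtain ⟨f, hf, h1, h2⟩ := h s hs hs1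
  refine ⟨f, hf, (h1.trans_lt hlt).trans_le ?_⟩
  rw [mul_assoc]
  gcongr

end MixedDispersion

theorem proposition5p2 (N : ℕ) (hN : 1 ≤ N) (α σ : ℝ) (hα : 0 < α)
    (hσ : 0 < σ) (hσN : σ * (N : ℝ) < 4) (hσmax : σ < max (4 / ((N : ℝ) + 1)) 1) :
    (∀ c : ℝ, 0 < c → MixedDispersion.mPhi N α σ c < 0) ∧
      (∀ γ β : ℝ, 0 < γ → 0 < β → MixedDispersion.c0 N γ β α σ = 0) := by
  open MixedDispersion in
  refine ⟨fun c hc ↦ ?_, fun γ β hγ hβ ↦ ?_⟩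
  · obtain ⟨f, hf, hlt⟩ := exists_norm_lap_add_smul_sq_lt hN (a := α / (2 * σ + 2)) hσ hσmax
      one_pos hc (by positivity)
    refine (iInf₂_le (toL2 f) hf).trans_lt ?_
    rw [one_smul] at hlt
    exact_mod_cast sub_neg.2 hlt
  · have hmem : ∀ c : ℝ, 0 < c →
        mE N γ β α σ c < ((-(β ^ 2 / (8 * γ)) * c : ℝ) : EReal) := by
      intro c hc
      obtain ⟨f, hf, hlt⟩ := exists_norm_lap_add_smul_sq_lt hN (κ := β / (2 * γ))
        -- The factor 2/γ is undone when the inequality is multiplied by γ/2.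
        (a := 2 / γ * (α / (2 * σ + 2))) hσ hσmax (by positivity) hc (by positivity)
      refine (iInf₂_le (toL2 f) hf).trans_lt (EReal.coe_lt_coe_iff.2 ?_)
      have hmass : ‖toL2 f‖ ^ 2 = c := by
        rw [norm_toL2_sq, ← integral_norm_sq_toL2]; exact hf.2
      rw [norm_lap_add_smul_sq, hmass] at hlt
      have h := mul_lt_mul_of_pos_left hlt (by positivity : 0 < γ / 2)
      have h1 : γ / 2 * (2 / γ * (α / (2 * σ + 2)) * powerInt σ (toL2 f)) =
          α / (2 * σ + 2) * powerInt σ (toL2 f) := by field_simp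
      have h2 : γ / 2 * (‖lap (toL2 f)‖ ^ 2 - 2 * (β / (2 * γ)) * gradNormSq (toL2 f) +
          (β / (2 * γ)) ^ 2 * c) = γ / 2 * ‖lap (toL2 f)‖ ^ 2 - β / 2 * gradNormSq (toL2 f) +
          β ^ 2 / (8 * γ) * c := by field_simp; ring
      rw [h1, h2] at h
      unfold energy
      linarith
    -- Every c > 0 is admissible, so the infimum lies below every positive real.
    apply le_antisymm
    · refine EReal.le_of_forall_lt_iff_le.1 fun c hc ↦ ?_
      have hc' : 0 < c := by exact_mod_cast hc
      exact iInf₂_le c ⟨hc', hmem c hc'⟩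
    · exact le_iInf₂ fun c hc ↦ by exact_mod_cast hc.1.le
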